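/- There is an absolute constant $C>0$ with the following property. Let $K\ge 1$ and $T\ge 2$ be integers and let $\rho,\delta\in\mathbb R$ be such that $$K\le \frac{T^{1/3}}{\log T},\qquad \rho\le \frac1{T^2},\qquad \delta\ge\sqrt{T\log T}.$$ Let $\mathbb A=[a_{\ell k}]$ be a doubly stochastic, symmetric and primitive $K\times K$ matrix, and let $L\ge0$ and $\alpha$ be real numbers. Then the following holds for every sufficiently large $\tau\in\mathbb N$ (larger than a bound that depends only on $K,T,\delta,\rho,\mathbb A,L,\alpha$). **The game.** In each round $t=1,\dots,T$ each arm $k\in\{1,\dots,K\}$ has a reward $r_{k,t}\in[0,1]$; all rewards are independent, and $r_{k,t}$ has the law $D_k$. Each arm $k$ offers a value $x_{k,t}$; the player pulls an arm $k_t$, sees $k_t$ and $x_{k_t,t}$, and receives $x_{k_t,t}$. **The player.** Let $h_t=(k_s,x_{k_s,s})_{s<t}$ be the history seen by the player before round $t$. The algorithm computes from $h_t$ an intrinsic information $I_{k,t}\in\mathbb R$ for each arm and pulls arm $k$ with conditional probability $p_{k,t}=\Pr_t(I_{k,t},\tilde I_t)$, where $\tilde I_t=\frac1K\sum_k I_{k,t}$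 and $\Pr_t:\mathbb R\times\mathbb R\to[0,1]$ is $L$-Lipschitz in its second argument (everything measurable, $\sum_k p_{k,t}=1$). It is assumed that $\frac1K\sum_k (I_{k,t}-\tilde I_t)^2\le\alpha$ for all $t\le T$ and all histories with reported values in $[0,1]$, and that the algorithm is $(\rho,\delta)$-low-regret: against every adaptive adversary that chooses the values $x_{k,t}\in[0,1]$ from the past, with probability at least $1-\rho$, $$\max_k\sum_{t=1}^T x_{k,t}-\sum_{t=1}^T x_{k_t,t}\le\delta .$$ **The arms' strategy.** Put $B=7\sqrt{KT\delta}$ and $\theta=\sqrt{K\delta/T}$, and let $N_k(s)$ be the number of pulls of arm $k$ in the first $s$ rounds. In round $t$ the arms put $\tilde I_{k,0}=I_{k,t}$ and $\tilde I_{k,n}=\sum_\ell a_{\ell k}\tilde I_{\ell,n-1}$ for $n=1,\dots,\tau$. If $N_k(s)<\frac sK-B$ at some past time $s<t$, then arm $k$ defects and offers $x_{k,t}=r_{k,t}$; otherwise it offers $x_{k,t}=\theta(1-\hat p_{k,t})$ with $\hat p_{k,t}=\Pr_t(I_{k,t},\tilde I_{k,\tau})$. **Conclusion.** If all arms follow this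 strategy, then, whatever the algorithm of the player (as above) and whatever the laws $D_1,\dots,D_K$ on $[0,1]$, the total revenue of the player has a finite expectation, and $$\mathbb E\Big[\sum_{t=1}^T x_{k_t,t}\Big]\le C\sqrt{KT\delta}.$$ -/

import Mathlib

open MeasureTheory

noncomputable section

namespace StrategicBandit

/-- The arithmetic mean of `v` over the `K` arms. -/
def mean {K : ℕ} (v : Fin K → ℝ) : ℝ := (∑ k, v k) / K

/-- A bandit algorithm of the player, for `K` arms. Rounds are numbered from `0`, so that round `t`
is preceded by exactly `t` completed rounds; the player has then seen the arms pulled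
(`Fin t → Fin K`) and the values that these arms reported (`Fin t → ℝ`).
From this history each arm `k` gets its intrinsic information `I_k = info t pulls reports k`, and
the player pulls arm `k` with probability `prob t I_k Ĩ`, where `Ĩ` is the average of the `I_k`.
(The parameters of the algorithm are part of `prob`; they may vary with the round.) -/
structure Algorithm (K : ℕ) where
  info : (t : ℕ) → (Fin t → Fin K) → (Fin t → ℝ) → Fin K → ℝ
  prob : ℕ → ℝ → ℝ → ℝ
  prob_mem : ∀ t I J, prob t I J ∈ Set.Icc (0 : ℝ) 1
  sum_prob : ∀ t pulls reports,
    ∑ k, prob t (info t pulls reports k) (mean (info t pulls reports)) = 1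
  measurable_info : ∀ t pulls k, Measurable fun reports => info t pulls reports k
  measurable_prob : ∀ t, Measurable fun z : ℝ × ℝ => prob t z.1 z.2

/-- `p_{k,t}`: the probability that the player pulls arm `k` in round `t`, after the given
history. -/
def Algorithm.pullProb {K : ℕ} (A : Algorithm K) (t : ℕ) (pulls : Fin t → Fin K)
    (reports : Fin t → ℝ) (k : Fin K) : ℝ :=
  A.prob t (A.info t pulls reports k) (mean (A.info t pulls reports))

/-- An adaptive rule for the values offered by the arms: `σ t pulls reports k` is the value
`x_{k,t}` that arm `k` reports in round `t`, if it is pulled, after the given history. -/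
abbrev OfferRule (K : ℕ) : Type :=
  (t : ℕ) → (Fin t → Fin K) → (Fin t → ℝ) → Fin K → ℝ

/-- The values reported to the player in the first `t` rounds, if the arms offer values by the
rule `σ` and the arms `pulls` are pulled. -/
def reports {K : ℕ} (σ : OfferRule K) : (t : ℕ) → (Fin t → Fin K) → Fin t → ℝ
  | 0, _ => Fin.elim0
  | t + 1, pulls =>
    Fin.snoc (α := fun _ => ℝ) (reports σ t (Fin.init pulls))
      (σ t (Fin.init pulls) (reports σ t (Fin.init pulls)) (pulls (Fin.last t)))

/-- The arms pulled before round `t`. -/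
def past {K T : ℕ} (pulls : Fin T → Fin K) (t : Fin T) : Fin (t : ℕ) → Fin K :=
  fun s => pulls (Fin.castLE t.isLt.le s)

/-- The value `x_{k,t}` offered by arm `k` in round `t`, if the arms `pulls` are pulled. -/
def offer {K T : ℕ} (σ : OfferRule K) (pulls : Fin T → Fin K) (t : Fin T) (k : Fin K) : ℝ :=
  σ t (past pulls t) (reports σ t (past pulls t)) k

/-- The probability that a player with algorithm `A` pulls the arms `pulls` in the first `T`
rounds, if the arms offer values by the rule `σ`. -/
def pathProb {K T : ℕ} (A : Algorithm K) (σ : OfferRule K) (pulls : Fin T → Fin K) : ℝ :=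
  ∏ t : Fin T, A.pullProb t (past pulls t) (reports σ t (past pulls t)) (pulls t)

/-- The total value received by the player. -/
def revenue {K T : ℕ} (σ : OfferRule K) (pulls : Fin T → Fin K) : ℝ :=
  ∑ t : Fin T, offer σ pulls t (pulls t)

/-- The regret `max_k ∑_t x_{k,t} - ∑_t x_{k_t,t}`. -/
def regret {K T : ℕ} (σ : OfferRule K) (pulls : Fin T → Fin K) : ℝ :=
  (⨆ k : Fin K, ∑ t : Fin T, offer σ pulls t k) - revenue σ pulls

open Classical in
/-- `A` is a `(ρ, δ)`-low-regret algorithm for the adversarial bandit problem with `T` rounds: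
against every adaptive adversary with values in `[0, 1]`, the regret is at most `δ` with
probability at least `1 - ρ`. -/
def Algorithm.IsLowRegret {K : ℕ} (A : Algorithm K) (T : ℕ) (ρ δ : ℝ) : Prop :=
  ∀ σ : OfferRule K, (∀ t pulls x k, σ t pulls x k ∈ Set.Icc (0 : ℝ) 1) →
    1 - ρ ≤ ∑ pulls : Fin T → Fin K with regret σ pulls ≤ δ, pathProb A σ pulls

/-- The pulling probability is `L`-Lipschitz as a function of the average information. -/
def Algorithm.IsLipschitz {K : ℕ} (A : Algorithm K) (L : NNReal) : Prop :=
  ∀ t I, LipschitzWith L (A.prob t I)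

/-- Before the arms communicate, the mean square distance of the information of the arms to its
average is at most `α`, in each of the first `T` rounds and whatever values in `[0, 1]` have been
reported. -/
def Algorithm.DisagreementLE {K : ℕ} (A : Algorithm K) (T : ℕ) (α : ℝ) : Prop :=
  ∀ t < T, ∀ (pulls : Fin t → Fin K) (x : Fin t → ℝ), (∀ s, x s ∈ Set.Icc (0 : ℝ) 1) →
    mean (fun k => (A.info t pulls x k - mean (A.info t pulls x)) ^ 2) ≤ α

/-- The combination matrix of the communication network is nonnegative with `a 𝟙 = 𝟙`, symmetric
and primitive. Arms `k`, `ℓ` are linked if `a ℓ k` is nonzero. -/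
structure IsCombinationMatrix {K : ℕ} (a : Matrix (Fin K) (Fin K) ℝ) : Prop where
  doublyStochastic : a ∈ doublyStochastic ℝ (Fin K)
  symm : a.IsSymm
  primitive : a.IsPrimitive

/-- The local averages `Ĩ_{k,n}` of the arms after `n` communication steps, starting from `I`. -/
def communicate {K : ℕ} (a : Matrix (Fin K) (Fin K) ℝ) (I : Fin K → ℝ) : ℕ → Fin K → ℝ
  | 0 => I
  | n + 1 => fun k => ∑ l, a l k * communicate a I n l

/-- `N_k(s)`: how often arm `k` is pulled in the first `s` rounds. -/
def pullCount {K t : ℕ} (pulls : Fin t → Fin K) (k : Fin K) (s : ℕ) : ℕ :=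
  (Finset.univ.filter fun i : Fin t => (i : ℕ) < s ∧ pulls i = k).card

/-- The threshold `B = 7 √(K T δ)`. -/
def threshold (K T : ℕ) (δ : ℝ) : ℝ := 7 * √(K * T * δ)

/-- The scale `θ = √(K δ / T)` of the offers. -/
def scale (K T : ℕ) (δ : ℝ) : ℝ := √(K * δ / T)

open Classical in
/-- The market-sharing strategy of the arms, with `τ` communication steps per round and rewards
`r t k`. Arm `k` defects, and offers its full reward, once there has been a time `s` with
`N_k(s) < s / K - B`; otherwise it offers `θ (1 - p̂_{k,t})`, where `p̂_{k,t}` is its estimate of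
its pulling probability, from its own information and its local average. -/
def strategy {K : ℕ} (A : Algorithm K) (a : Matrix (Fin K) (Fin K) ℝ) (τ T : ℕ) (δ : ℝ)
    (r : ℕ → Fin K → ℝ) : OfferRule K := fun t pulls x k =>
  if ∃ s ≤ t, (pullCount pulls k s : ℝ) < (s : ℝ) / K - threshold K T δ then r t k
  else scale K T δ *
    (1 - A.prob t (A.info t pulls x k) (communicate a (A.info t pulls x) τ k))

/-- The law of the rewards: all `r_{k,t}` are independent, and `r_{k,t}` has law `D k`. -/
def rewardLaw {K : ℕ} (D : Fin K → ProbabilityMeasure unitInterval) :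
    Measure (ℕ × Fin K → unitInterval) :=
  Measure.infinitePi fun p => (D p.2 : Measure unitInterval)

/-- The expectation of the revenue over the random choices of the player, for given rewards, if
the arms follow the market-sharing strategy. -/
def revenueGivenRewards {K : ℕ} (A : Algorithm K) (a : Matrix (Fin K) (Fin K) ℝ) (τ T : ℕ)
    (δ : ℝ) (r : ℕ × Fin K → unitInterval) : ℝ :=
  let σ := strategy A a τ T δ fun t k => (r (t, k) : ℝ)
  ∑ pulls : Fin T → Fin K, pathProb A σ pulls * revenue σ pulls

end StrategicBandit

end

open MeasureTheory

noncomputable section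

namespace StrategicBandit

/-! ### Consensus -/

/-! Write `θ`, `B` for the scale and threshold, and `Q = √(K T δ) = T θ`. As long as no arm defects,
each round pays at most `θ`, hence at most `Q` in total; it remains to show that defection is rare.

Offers `θ (1 - p_k)` turn low regret into market sharing. The regret against arm `k` is `θ ∑
(p_{k_t} - p_k)`, so low regret bounds this sum by `δ / θ`. On the other hand, `1{k_t = k} - 1/K +
p_{k_t} - p_k` has conditional mean `∑ p_j ^ 2 - 1/K ≥ 0` by Cauchy–Schwarz
(`sum_pullProb_mul_shareGap_nonneg`), and a Chernoff bound (`sum_pathProb_filter_le`) makes a very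
negative sum of these increments unlikely. Hence `N_k(s) - s/K` seldom falls below `-B`
(`exists_sum_shareGap_le`, `sum_pathProb_deficient_le`).

The regret bound covers only the full horizon, while the first deficiency occurs at a random time.
It is therefore applied to the adversary `cooperation`, whose offers vanish from that time on, so
that later rounds add no regret. Up to that time it agrees with `strategy`, so both have the same
probability of a deficiency.

The arms only estimate `p_k`; since powers of a primitive doubly stochastic matrix contract to the
mean, enough communication makes the error negligible (`exists_abs_prob_sub_pullProb_le`). -/

lemma communicate_eq_vecMul {K : ℕ} (a : Matrix (Fin K) (Fin K) ℝ) (I : Fin K → ℝ) (n : ℕ) :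
    communicate a I n = Matrix.vecMul I (a ^ n) := by
  induction n with
  | zero => simp [communicate]
  | succ n ih =>
    rw [pow_succ, ← Matrix.vecMul_vecMul, ← ih]
    funext k
    simp [communicate, Matrix.vecMul, dotProduct, mul_comm]

lemma sum_vecMul {K : ℕ} {a : Matrix (Fin K) (Fin K) ℝ} (ha : a ∈ doublyStochastic ℝ (Fin K))
    (v : Fin K → ℝ) : ∑ k, Matrix.vecMul v a k = ∑ k, v k := by
  simp only [Matrix.vecMul, dotProduct]
  rw [Finset.sum_comm]
  refine Finset.sum_congr rfl fun l _ => ?_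
  rw [← Finset.mul_sum, sum_row_of_mem_doublyStochastic ha, mul_one]

/-- A doubly stochastic matrix with entries at least `c` contracts zero-sum vectors in the sup norm
by the factor `1 - K c`. -/
lemma abs_vecMul_le {K : ℕ} {a : Matrix (Fin K) (Fin K) ℝ} (ha : a ∈ doublyStochastic ℝ (Fin K))
    {c M : ℝ} (hc : ∀ i j, c ≤ a i j) {v : Fin K → ℝ} (hv : ∑ k, v k = 0) (hM : ∀ k, |v k| ≤ M)
    (k : Fin K) : |Matrix.vecMul v a k| ≤ (1 - K * c) * M := by
  -- Subtracting a constant from a column is free on zero-sum vectors; the remaining entries are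
  -- nonnegative with column sum `1 - K c`.
  have h : Matrix.vecMul v a k = ∑ l, (a l k - c) * v l := by
    simp only [Matrix.vecMul, dotProduct, sub_mul, Finset.sum_sub_distrib, ← Finset.mul_sum, hv,
      mul_zero, sub_zero]
    exact Finset.sum_congr rfl fun l _ => mul_comm _ _
  calc |Matrix.vecMul v a k| ≤ ∑ l, |(a l k - c) * v l| := by
        rw [h]; exact Finset.abs_sum_le_sum_abs _ _
    _ ≤ ∑ l, (a l k - c) * M := by
        refine Finset.sum_le_sum fun l _ => ?_
        rw [abs_mul, abs_of_nonneg (sub_nonneg.2 (hc l k))]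
        exact mul_le_mul_of_nonneg_left (hM l) (sub_nonneg.2 (hc l k))
    _ = (1 - K * c) * M := by
        rw [← Finset.sum_mul, Finset.sum_sub_distrib, sum_col_of_mem_doublyStochastic ha]
        simp

/-- Some power `a ^ m` is entrywise positive, so every block of `m` steps contracts the deviation
from the mean by a fixed factor below `1`. The bound is uniform in `I`, which lets `τ₀` be chosen
before the algorithm. -/
lemma exists_communicate_sub_mean_le {K : ℕ} (hK : 1 ≤ K) {a : Matrix (Fin K) (Fin K) ℝ}
    (ha : IsCombinationMatrix a) (M : ℝ) {ε : ℝ} (hε : 0 < ε) :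
    ∃ τ₀ : ℕ, ∀ τ ≥ τ₀, ∀ I : Fin K → ℝ, (∀ k, |I k - mean I| ≤ M) →
      ∀ k, |communicate a I τ k - mean I| ≤ ε := by
  obtain ⟨m, -, hm⟩ := ha.primitive.exists_pos_pow
  have hK' : (0 : ℝ) < K := by exact_mod_cast hK
  have : Nonempty (Fin K) := ⟨⟨0, hK⟩⟩
  have hpow : ∀ n, a ^ n ∈ doublyStochastic ℝ (Fin K) := fun n => pow_mem ha.doublyStochastic n
  obtain ⟨x, hx⟩ := Finite.exists_min fun x : Fin K × Fin K => (a ^ m) x.1 x.2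
  set c := (a ^ m) x.1 x.2 with hcdef
  have hc0 : 0 < c := hm _ _
  have hc : ∀ i j, c ≤ (a ^ m) i j := fun i j => hx (i, j)
  have hKc : K * c ≤ 1 := by
    rw [← sum_row_of_mem_doublyStochastic (hpow m) x.1]
    simpa using Finset.sum_le_sum fun j (_ : j ∈ Finset.univ) => hc x.1 j
  have hr0 : 0 ≤ 1 - K * c := by linarith
  have hr1 : 1 - K * c < 1 := by have := mul_pos hK' hc0; linarith
  have hlim : Filter.Tendsto (fun q : ℕ => (1 - K * c) ^ q * M) Filter.atTop (nhds 0) := by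
    simpa using (tendsto_pow_atTop_nhds_zero_of_lt_one hr0 hr1).mul_const M
  obtain ⟨q, hq⟩ := (hlim.eventually (gt_mem_nhds hε)).exists
  refine ⟨m * q, fun τ hτ I hI k => ?_⟩
  obtain ⟨d, rfl⟩ := Nat.exists_eq_add_of_le hτ
  set v : Fin K → ℝ := fun k => I k - mean I with hv
  have hv0 : ∑ k, v k = 0 := by
    simp only [hv, Finset.sum_sub_distrib, mean, Finset.sum_const, Finset.card_univ,
      Fintype.card_fin, nsmul_eq_mul]
    field_simp
    ring
  have hiter : ∀ q : ℕ, ∀ k, |Matrix.vecMul v (a ^ (m * q)) k| ≤ (1 - K * c) ^ q * M := by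
    intro q
    induction q with
    | zero => simpa using hI
    | succ q ih =>
      intro k
      rw [Nat.mul_succ, pow_add, ← Matrix.vecMul_vecMul, pow_succ', mul_assoc]
      exact abs_vecMul_le (hpow m) hc ((sum_vecMul (hpow _) v).trans hv0) ih k
  -- The `d` leftover steps need not contract; with `c = 0` they at least do not expand.
  have hfin : |Matrix.vecMul v (a ^ (m * q + d)) k| ≤ (1 - K * c) ^ q * M := by
    rw [pow_add, ← Matrix.vecMul_vecMul]
    simpa using abs_vecMul_le (hpow d) (c := 0)
      (fun i j => nonneg_of_mem_doublyStochastic (hpow d))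
      ((sum_vecMul (hpow _) v).trans hv0) (hiter q) k
  have heq : communicate a I (m * q + d) k - mean I = Matrix.vecMul v (a ^ (m * q + d)) k := by
    rw [communicate_eq_vecMul]
    simp only [Matrix.vecMul, dotProduct, hv, sub_mul, Finset.sum_sub_distrib, ← Finset.mul_sum,
      sum_col_of_mem_doublyStochastic (hpow _), mul_one]
  rw [heq]
  exact hfin.trans hq.le

/-- A vector is within `√(K α)` of its mean if its mean square distance to it is at most `α`. -/
lemma abs_sub_mean_le {K : ℕ} (hK : 1 ≤ K) {I : Fin K → ℝ} {α : ℝ}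
    (h : mean (fun k => (I k - mean I) ^ 2) ≤ α) (k : Fin K) : |I k - mean I| ≤ √(K * α) := by
  have hK' : (0 : ℝ) < K := by exact_mod_cast hK
  refine Real.abs_le_sqrt ?_
  rw [mean, div_le_iff₀ hK', mul_comm] at h
  exact (Finset.single_le_sum (f := fun k => (I k - mean I) ^ 2) (fun _ _ => sq_nonneg _)
    (Finset.mem_univ k)).trans h

/-! ### Paths -/

lemma Algorithm.pullProb_nonneg {K : ℕ} (A : Algorithm K) (t : ℕ) (p : Fin t → Fin K)
    (x : Fin t → ℝ) (k : Fin K) : 0 ≤ A.pullProb t p x k := (A.prob_mem _ _ _).1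

lemma Algorithm.pullProb_le_one {K : ℕ} (A : Algorithm K) (t : ℕ) (p : Fin t → Fin K)
    (x : Fin t → ℝ) (k : Fin K) : A.pullProb t p x k ≤ 1 := (A.prob_mem _ _ _).2

lemma Algorithm.sum_pullProb {K : ℕ} (A : Algorithm K) (t : ℕ) (p : Fin t → Fin K)
    (x : Fin t → ℝ) : ∑ k, A.pullProb t p x k = 1 := A.sum_prob _ _ _

lemma pathProb_nonneg {K T : ℕ} (A : Algorithm K) (σ : OfferRule K) (p : Fin T → Fin K) :
    0 ≤ pathProb A σ p := Finset.prod_nonneg fun _ _ => A.pullProb_nonneg _ _ _ _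

lemma past_snoc_castSucc {K n : ℕ} (p : Fin n → Fin K) (k : Fin K) (t : Fin n) :
    past (Fin.snoc (α := fun _ => Fin K) p k) t.castSucc = past p t := by
  funext s
  exact Fin.snoc_castSucc (α := fun _ => Fin K) k p (Fin.castLE t.isLt.le s)

lemma past_snoc_last {K n : ℕ} (p : Fin n → Fin K) (k : Fin K) :
    past (Fin.snoc (α := fun _ => Fin K) p k) (Fin.last n) = p := by
  funext s
  exact Fin.snoc_castSucc (α := fun _ => Fin K) k p s

lemma pathProb_snoc {K n : ℕ} (A : Algorithm K) (σ : OfferRule K) (p : Fin n → Fin K)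
    (k : Fin K) : pathProb A σ (Fin.snoc (α := fun _ => Fin K) p k) =
      pathProb A σ p * A.pullProb n p (reports σ n p) k := by
  unfold pathProb
  rw [Fin.prod_univ_castSucc]
  congr 1
  · refine Finset.prod_congr rfl fun t _ => ?_
    rw [past_snoc_castSucc]
    simp
  · rw [past_snoc_last]
    simp

/-- Conditioning on the first `n` rounds: the tower property that drives the inductions on the
horizon. -/
lemma sum_pathProb_succ {K n : ℕ} (A : Algorithm K) (σ : OfferRule K)
    (f : (Fin (n + 1) → Fin K) → ℝ) :
    ∑ q, pathProb A σ q * f q = ∑ p : Fin n → Fin K, pathProb A σ p *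
      ∑ k, A.pullProb n p (reports σ n p) k * f (Fin.snoc (α := fun _ => Fin K) p k) := by
  rw [← (Fin.snocEquiv fun _ : Fin (n + 1) => Fin K).sum_comp, Fintype.sum_prod_type_right]
  refine Finset.sum_congr rfl fun p _ => ?_
  rw [Finset.mul_sum]
  refine Finset.sum_congr rfl fun k _ => ?_
  rw [← mul_assoc, ← pathProb_snoc]
  rfl

lemma sum_pathProb {K : ℕ} (A : Algorithm K) (σ : OfferRule K) (n : ℕ) :
    ∑ p : Fin n → Fin K, pathProb A σ p = 1 := by
  induction n with
  | zero => simp [pathProb]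
  | succ n ih =>
    have := sum_pathProb_succ A σ (n := n) fun _ => 1
    simpa [A.sum_pullProb, ih] using this

/-- Chernoff bound: the moment generating function of a sum of increments that are bounded by `2`
and have nonnegative conditional mean. -/
lemma sum_pathProb_mul_exp_le {K : ℕ} (A : Algorithm K) (σ : OfferRule K)
    (W : (t : ℕ) → (Fin t → Fin K) → Fin K → ℝ) (hW : ∀ t p k, |W t p k| ≤ 2)
    (hmean : ∀ t p, 0 ≤ ∑ k, A.pullProb t p (reports σ t p) k * W t p k)
    {l : ℝ} (hl0 : 0 ≤ l) (hl : l ≤ 1 / 2) (n : ℕ) :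
    ∑ p : Fin n → Fin K, pathProb A σ p * Real.exp (-l * ∑ t : Fin n, W t (past p t) (p t)) ≤
      Real.exp (4 * l ^ 2 * n) := by
  induction n with
  | zero => simp [pathProb]
  | succ n ih =>
    rw [sum_pathProb_succ]
    have hstep : ∀ p : Fin n → Fin K, ∑ k, A.pullProb n p (reports σ n p) k *
        Real.exp (-l * W n p k) ≤ Real.exp (4 * l ^ 2) := by
      intro p
      -- This is `exp x ≤ 1 + x + x ^ 2` for `|x| ≤ 1`, which is where `l ≤ 1 / 2` enters.
      have h1 : ∀ k, Real.exp (-l * W n p k) ≤ 1 + 4 * l ^ 2 - l * W n p k := by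
        intro k
        have hb := hW n p k
        have hx : |-l * W n p k| ≤ 1 := by
          rw [abs_mul, abs_neg, abs_of_nonneg hl0]
          nlinarith [abs_nonneg (W n p k)]
        have h2 := (abs_le.1 (Real.abs_exp_sub_one_sub_id_le hx)).2
        have h3 : W n p k ^ 2 ≤ 4 := by
          rw [← sq_abs]; nlinarith [abs_nonneg (W n p k)]
        nlinarith [mul_le_mul_of_nonneg_left h3 (sq_nonneg l)]
      calc _ ≤ ∑ k, A.pullProb n p (reports σ n p) k * (1 + 4 * l ^ 2 - l * W n p k) :=
            Finset.sum_le_sum fun k _ =>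
              mul_le_mul_of_nonneg_left (h1 k) (A.pullProb_nonneg _ _ _ _)
        _ = 1 + 4 * l ^ 2 - l * ∑ k, A.pullProb n p (reports σ n p) k * W n p k := by
            simp only [mul_sub, Finset.sum_sub_distrib, ← Finset.sum_mul, A.sum_pullProb, one_mul,
              Finset.mul_sum]
            congr 1
            exact Finset.sum_congr rfl fun k _ => by ring
        _ ≤ 1 + 4 * l ^ 2 := by linarith [mul_nonneg hl0 (hmean n p)]
        _ ≤ Real.exp (4 * l ^ 2) := by linarith [Real.add_one_le_exp (4 * l ^ 2)]
    have hsplit : ∀ (p : Fin n → Fin K) (k : Fin K),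
        Real.exp (-l * ∑ t : Fin (n + 1), W t (past (Fin.snoc (α := fun _ => Fin K) p k) t)
          (Fin.snoc (α := fun _ => Fin K) p k t)) =
        Real.exp (-l * ∑ t : Fin n, W t (past p t) (p t)) * Real.exp (-l * W n p k) := by
      intro p k
      rw [← Real.exp_add, ← mul_add, Fin.sum_univ_castSucc]
      congr 3
      · refine Finset.sum_congr rfl fun t _ => ?_
        rw [past_snoc_castSucc]
        simp
      · rw [past_snoc_last]
        simp
    calc _ = ∑ p : Fin n → Fin K, pathProb A σ p *
            Real.exp (-l * ∑ t : Fin n, W t (past p t) (p t)) *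
            ∑ k, A.pullProb n p (reports σ n p) k * Real.exp (-l * W n p k) := by
          refine Finset.sum_congr rfl fun p _ => ?_
          rw [mul_assoc, Finset.mul_sum _ _ (Real.exp _)]
          congr 1
          refine Finset.sum_congr rfl fun k _ => ?_
          rw [hsplit]
          ring
      _ ≤ ∑ p : Fin n → Fin K, pathProb A σ p *
            Real.exp (-l * ∑ t : Fin n, W t (past p t) (p t)) * Real.exp (4 * l ^ 2) :=
          Finset.sum_le_sum fun p _ => mul_le_mul_of_nonneg_left (hstep p)
            (mul_nonneg (pathProb_nonneg _ _ _) (Real.exp_nonneg _))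
      _ ≤ Real.exp (4 * l ^ 2 * n) * Real.exp (4 * l ^ 2) := by
          rw [← Finset.sum_mul]
          exact mul_le_mul_of_nonneg_right ih (Real.exp_nonneg _)
      _ = _ := by rw [← Real.exp_add]; push_cast; ring_nf

open Classical in
-- Markov's inequality applied to the exponential moment.
lemma sum_pathProb_filter_le {K : ℕ} (A : Algorithm K) (σ : OfferRule K)
    (W : (t : ℕ) → (Fin t → Fin K) → Fin K → ℝ) (hW : ∀ t p k, |W t p k| ≤ 2)
    (hmean : ∀ t p, 0 ≤ ∑ k, A.pullProb t p (reports σ t p) k * W t p k)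
    {l : ℝ} (hl0 : 0 ≤ l) (hl : l ≤ 1 / 2) (n : ℕ) (u : ℝ) :
    ∑ p : Fin n → Fin K with ∑ t : Fin n, W t (past p t) (p t) ≤ -u, pathProb A σ p ≤
      Real.exp (4 * l ^ 2 * n - l * u) := by
  rw [Real.exp_sub, le_div_iff₀ (Real.exp_pos _)]
  refine le_trans ?_ (sum_pathProb_mul_exp_le A σ W hW hmean hl0 hl n)
  rw [Finset.sum_mul]
  refine le_trans (Finset.sum_le_sum fun p hp => ?_)
    (Finset.sum_le_sum_of_subset_of_nonneg (Finset.filter_subset _ _) fun p _ _ =>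
      mul_nonneg (pathProb_nonneg A σ p) (Real.exp_nonneg _))
  refine mul_le_mul_of_nonneg_left (Real.exp_le_exp.2 ?_) (pathProb_nonneg _ _ _)
  have := mul_le_mul_of_nonneg_left (Finset.mem_filter.1 hp).2 hl0
  linarith

/-! ### Dependence of reports, path probabilities and counts on the history -/

lemma reports_apply {K n : ℕ} (σ : OfferRule K) (p : Fin n → Fin K) (t : Fin n) :
    reports σ n p t = offer σ p t (p t) := by
  induction n with
  | zero => exact t.elim0
  | succ n ih =>
    refine Fin.lastCases ?_ (fun t => ?_) t
    · simp only [reports, Fin.snoc_last]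
      rfl
    · simp only [reports, Fin.snoc_castSucc, ih]
      rfl

/-- Agreement is needed only along the prefixes of the given path, which suffices to compare
`strategy` with `cooperation` on a path without deficiency. -/
lemma reports_congr {K n : ℕ} {σ σ' : OfferRule K} (p : Fin n → Fin K)
    (h : ∀ (t : Fin n) x k, σ t (past p t) x k = σ' t (past p t) x k) :
    reports σ n p = reports σ' n p := by
  induction n with
  | zero => rfl
  | succ n ih =>
    have h1 : reports σ n (Fin.init p) = reports σ' n (Fin.init p) :=
      ih (Fin.init p) fun t x k => h t.castSucc x k
    have h2 := h (Fin.last n) (reports σ' n (Fin.init p)) (p (Fin.last n))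
    simp only [reports, h1]
    exact congrArg (Fin.snoc (α := fun _ => ℝ) (reports σ' n (Fin.init p))) h2

lemma reports_past_congr {K n : ℕ} {σ σ' : OfferRule K} (p : Fin n → Fin K)
    (h : ∀ (t : Fin n) x k, σ t (past p t) x k = σ' t (past p t) x k) (t : Fin n) :
    reports σ t (past p t) = reports σ' t (past p t) :=
  reports_congr _ fun s x k => h (Fin.castLE t.isLt.le s) x k

lemma pathProb_congr {K n : ℕ} (A : Algorithm K) {σ σ' : OfferRule K} (p : Fin n → Fin K)
    (h : ∀ (t : Fin n) x k, σ t (past p t) x k = σ' t (past p t) x k) :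
    pathProb A σ p = pathProb A σ' p :=
  Finset.prod_congr rfl fun t _ => by rw [reports_past_congr p h]

lemma reports_mem {K n : ℕ} {σ : OfferRule K} {S : Set ℝ} (h : ∀ t p x k, σ t p x k ∈ S)
    (p : Fin n → Fin K) (t : Fin n) : reports σ n p t ∈ S := by
  rw [reports_apply]
  exact h _ _ _ _

lemma pullCount_past {K T : ℕ} (p : Fin T → Fin K) (t : Fin T) (k : Fin K) {s : ℕ}
    (hs : s ≤ t) : pullCount (past p t) k s = pullCount p k s := by
  unfold pullCount
  refine Finset.card_bij (fun i _ => Fin.castLE t.isLt.le i) ?_ ?_ ?_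
  · intro i hi
    exact Finset.mem_filter.2 ⟨Finset.mem_univ _, (Finset.mem_filter.1 hi).2⟩
  · intro i _ j _ hij
    exact Fin.castLE_injective _ hij
  · intro i hi
    have hi' := (Finset.mem_filter.1 hi).2
    exact ⟨⟨i, hi'.1.trans_le hs⟩, Finset.mem_filter.2 ⟨Finset.mem_univ _, hi'⟩, rfl⟩

/-! ### The cooperative phase -/

/-- Some arm has been pulled less than `s / K - B` times in the first `s` rounds. -/
def Deficient {K t : ℕ} (B : ℝ) (p : Fin t → Fin K) (s : ℕ) : Prop :=
  ∃ k, (pullCount p k s : ℝ) < (s : ℝ) / K - B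

lemma deficient_past {K T : ℕ} (B : ℝ) (p : Fin T → Fin K) (t : Fin T) {s : ℕ} (hs : s ≤ t) :
    Deficient B (past p t) s ↔ Deficient B p s := by
  simp only [Deficient, pullCount_past p t _ hs]

open Classical in
/-- The offers of the market-sharing strategy up to the first deficiency; afterwards all arms offer
`0`. -/
def cooperation {K : ℕ} (A : Algorithm K) (a : Matrix (Fin K) (Fin K) ℝ) (τ T : ℕ) (δ : ℝ) :
    OfferRule K := fun t p x k =>
  if ∃ s ≤ t, Deficient (threshold K T δ) p s then 0
  else scale K T δ * (1 - A.prob t (A.info t p x k) (communicate a (A.info t p x) τ k))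

open Classical in
/-- The increments of the count of arm `k` relative to its fair share, corrected by the difference
of the pulling probabilities of the pulled arm `j` and of `k`, up to the first deficiency. -/
def shareGap {K : ℕ} (A : Algorithm K) (σ : OfferRule K) (B : ℝ) (k : Fin K) (t : ℕ)
    (p : Fin t → Fin K) (j : Fin K) : ℝ :=
  if ∃ s ≤ t, Deficient B p s then 0
  else (if j = k then 1 else 0) - 1 / K + A.pullProb t p (reports σ t p) j -
    A.pullProb t p (reports σ t p) k

lemma abs_shareGap_le {K : ℕ} (hK : 1 ≤ K) (A : Algorithm K) (σ : OfferRule K) (B : ℝ)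
    (k : Fin K) (t : ℕ) (p : Fin t → Fin K) (j : Fin K) : |shareGap A σ B k t p j| ≤ 2 := by
  have hK' : (1 : ℝ) ≤ K := by exact_mod_cast hK
  have h1 : 1 / (K : ℝ) ≤ 1 := by rw [div_le_one (by linarith)]; exact hK'
  have h0 : 0 ≤ 1 / (K : ℝ) := by positivity
  have hj0 := A.pullProb_nonneg t p (reports σ t p) j
  have hj1 := A.pullProb_le_one t p (reports σ t p) j
  have hk0 := A.pullProb_nonneg t p (reports σ t p) k
  have hk1 := A.pullProb_le_one t p (reports σ t p) k
  unfold shareGap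
  rw [abs_le]
  split_ifs
  · norm_num
  · constructor <;> linarith
  · constructor <;> linarith

/-- Before a deficiency the conditional mean is `∑ q_j ^ 2 - 1/K`, which is nonnegative by
Cauchy–Schwarz because `∑ q_j = 1`. -/
lemma sum_pullProb_mul_shareGap_nonneg {K : ℕ} (hK : 1 ≤ K) (A : Algorithm K) (σ : OfferRule K)
    (B : ℝ) (k : Fin K) (t : ℕ) (p : Fin t → Fin K) :
    0 ≤ ∑ j, A.pullProb t p (reports σ t p) j * shareGap A σ B k t p j := by
  classical
  have hK' : (0 : ℝ) < K := by exact_mod_cast hK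
  unfold shareGap
  split_ifs with h
  · simp
  set q := A.pullProb t p (reports σ t p) with hq
  have hq1 : ∑ j, q j = 1 := A.sum_pullProb _ _ _
  have hsum : ∑ j, q j * ((if j = k then 1 else 0) - 1 / K + q j - q k) =
      ∑ j, q j ^ 2 - 1 / K := by
    have : ∀ j, q j * ((if j = k then 1 else 0) - 1 / K + q j - q k) =
        (if j = k then q j else 0) - q j * (1 / K) + q j ^ 2 - q j * q k := by
      intro j
      split_ifs <;> ring
    simp only [this, Finset.sum_sub_distrib, Finset.sum_add_distrib, ← Finset.sum_mul, hq1,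
      Finset.sum_ite_eq', Finset.mem_univ, if_true]
    ring
  have hcs := sq_sum_le_card_mul_sum_sq (s := Finset.univ) (f := q)
  rw [hq1, Finset.card_univ, Fintype.card_fin, one_pow] at hcs
  rw [hsum, sub_nonneg, div_le_iff₀ hK']
  linarith

lemma sum_indicator_lt {S T : ℕ} (h : S ≤ T) (c : ℝ) :
    ∑ t : Fin T, (if (t : ℕ) < S then c else 0) = S * c := by
  rw [Fin.sum_univ_eq_sum_range (fun t => if t < S then c else 0) T, ← Finset.sum_filter]
  have : (Finset.range T).filter (· < S) = Finset.range S := by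
    ext; simp; omega
  rw [this]
  simp

/-- If a deficiency occurs although the regret is small, then the corrected count of some arm is
small. -/
lemma exists_sum_shareGap_le {K T τ : ℕ} {δ ε : ℝ} {A : Algorithm K}
    {a : Matrix (Fin K) (Fin K) ℝ} (hθ : 0 < scale K T δ)
    (p : Fin T → Fin K)
    (hε : ∀ (t : Fin T) k,
      |A.prob t (A.info t (past p t) (reports (cooperation A a τ T δ) t (past p t)) k)
          (communicate a
            (A.info t (past p t) (reports (cooperation A a τ T δ) t (past p t))) τ k) -
        A.pullProb t (past p t) (reports (cooperation A a τ T δ) t (past p t)) k| ≤ ε)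
    (hreg : regret (cooperation A a τ T δ) p ≤ δ)
    (hdef : ∃ s < T, Deficient (threshold K T δ) p s) :
    ∃ k, ∑ t : Fin T, shareGap A (cooperation A a τ T δ) (threshold K T δ) k t (past p t) (p t) ≤
      -threshold K T δ + δ / scale K T δ + 2 * ε * T := by
  classical
  set σ := cooperation A a τ T δ with hσ
  set B := threshold K T δ with hB
  set θ := scale K T δ with hθd
  -- By minimality of the first deficient time `S`, the truncated offers and increments are active
  -- exactly in the rounds `t < S`.
  let S := Nat.find hdef
  obtain ⟨hST, k, hk⟩ : S < T ∧ Deficient B p S := Nat.find_spec hdef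
  have hact : ∀ t : Fin T, (∃ s ≤ (t : ℕ), Deficient B (past p t) s) ↔ ¬ (t : ℕ) < S := by
    intro t
    constructor
    · rintro ⟨s, hs, hd⟩ hlt
      exact Nat.find_min hdef (hs.trans_lt hlt)
        ⟨hs.trans_lt t.isLt, (deficient_past B p t hs).1 hd⟩
    · intro h
      exact ⟨S, not_lt.1 h, (deficient_past B p t (not_lt.1 h)).2 ⟨k, hk⟩⟩
  have hε0 : 0 ≤ ε := (abs_nonneg _).trans (hε ⟨S, hST⟩ k)
  -- For `t < S`, `p_{k_t} - p_k` is the offer difference divided by `θ`, up to an error `ε` for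
  -- each of the two estimates. Summation gives the count deficit `-B`, the scaled regret `δ / θ`
  -- and the total error `2 ε T`.
  have hpt : ∀ t : Fin T, shareGap A σ B k t (past p t) (p t) ≤
      (if (t : ℕ) < S ∧ p t = k then 1 else 0) - (if (t : ℕ) < S then 1 / (K : ℝ) else 0) +
        (offer σ p t k - offer σ p t (p t)) / θ + 2 * ε := by
    intro t
    by_cases hlt : (t : ℕ) < S
    · have hn : ¬ ∃ s ≤ (t : ℕ), Deficient B (past p t) s := fun h => (hact t).1 h hlt
      have ho : ∀ j, offer σ p t j = θ * (1 - A.prob t (A.info t (past p t)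
          (reports σ t (past p t)) j) (communicate a (A.info t (past p t)
          (reports σ t (past p t))) τ j)) := by
        intro j
        simp only [offer]
        conv_lhs => rw [hσ]
        exact if_neg hn
      have h1 := abs_le.1 (hε t k)
      have h2 := abs_le.1 (hε t (p t))
      rw [ho, ho, ← mul_sub, mul_div_cancel_left₀ _ hθ.ne']
      simp only [shareGap, if_neg hn, hlt, true_and, if_true]
      linarith
    · simp only [shareGap, if_pos ((hact t).2 hlt), hlt, false_and, if_false]
      have ho : ∀ j, offer σ p t j = 0 := fun j => if_pos ((hact t).2 hlt)
      simp only [ho, sub_zero, zero_div]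
      linarith
  refine ⟨k, (Finset.sum_le_sum fun t _ => hpt t).trans ?_⟩
  rw [Finset.sum_add_distrib, Finset.sum_add_distrib, Finset.sum_sub_distrib,
    sum_indicator_lt hST.le, ← Finset.sum_div, Finset.sum_sub_distrib]
  have hcount : ∑ t : Fin T, (if (t : ℕ) < S ∧ p t = k then (1 : ℝ) else 0) = pullCount p k S := by
    rw [pullCount, Finset.sum_boole]
  have hr : ∑ t : Fin T, offer σ p t k - ∑ t : Fin T, offer σ p t (p t) ≤ δ := by
    refine le_trans ?_ hreg
    exact sub_le_sub_right (le_ciSup (f := fun k => ∑ t : Fin T, offer σ p t k)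
      (Set.finite_range _).bddAbove k) _
  have hr' := div_le_div_of_nonneg_right hr hθ.le
  rw [hcount, Finset.sum_const, Finset.card_univ, Fintype.card_fin, nsmul_eq_mul]
  have : (S : ℝ) * (1 / K) = S / K := by ring
  linarith

/-! ### Comparison of the strategy with its cooperative truncation -/

/-- The offers of the cooperative phase lie in `[0, 1]`. -/
lemma cooperation_mem {K : ℕ} (A : Algorithm K) (a : Matrix (Fin K) (Fin K) ℝ) (τ T : ℕ) {δ : ℝ}
    (hθ : scale K T δ ≤ 1) (t : ℕ) (p : Fin t → Fin K) (x : Fin t → ℝ) (k : Fin K) :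
    cooperation A a τ T δ t p x k ∈ Set.Icc (0 : ℝ) 1 := by
  have h0 : 0 ≤ scale K T δ := Real.sqrt_nonneg _
  obtain ⟨h1, h2⟩ := A.prob_mem t (A.info t p x k) (communicate a (A.info t p x) τ k)
  unfold cooperation
  split_ifs
  · simp
  · exact ⟨mul_nonneg h0 (by linarith), by nlinarith⟩

lemma strategy_nonneg {K : ℕ} (A : Algorithm K) (a : Matrix (Fin K) (Fin K) ℝ) (τ T : ℕ) (δ : ℝ)
    {r : ℕ → Fin K → ℝ} (hr : ∀ t k, r t k ∈ Set.Icc (0 : ℝ) 1) (t : ℕ) (p : Fin t → Fin K)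
    (x : Fin t → ℝ) (k : Fin K) : 0 ≤ strategy A a τ T δ r t p x k := by
  have h0 : 0 ≤ scale K T δ := Real.sqrt_nonneg _
  obtain ⟨h1, h2⟩ := A.prob_mem t (A.info t p x k) (communicate a (A.info t p x) τ k)
  unfold strategy
  split_ifs
  · exact (hr t k).1
  · exact mul_nonneg h0 (by linarith)

lemma strategy_le {K : ℕ} (A : Algorithm K) (a : Matrix (Fin K) (Fin K) ℝ) (τ T : ℕ) (δ : ℝ)
    {r : ℕ → Fin K → ℝ} (hr : ∀ t k, r t k ∈ Set.Icc (0 : ℝ) 1) (t : ℕ) (p : Fin t → Fin K)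
    (x : Fin t → ℝ) (k : Fin K) : strategy A a τ T δ r t p x k ≤ max 1 (scale K T δ) := by
  have h0 : 0 ≤ scale K T δ := Real.sqrt_nonneg _
  obtain ⟨h1, h2⟩ := A.prob_mem t (A.info t p x k) (communicate a (A.info t p x) τ k)
  unfold strategy
  split_ifs
  · exact (hr t k).2.trans (le_max_left _ _)
  · exact le_trans (by nlinarith) (le_max_right _ _)

/-- Without deficiency, no arm defects. -/
lemma strategy_of_not_deficient {K T : ℕ} (A : Algorithm K) (a : Matrix (Fin K) (Fin K) ℝ)
    (τ : ℕ) (δ : ℝ) (r : ℕ → Fin K → ℝ) {p : Fin T → Fin K}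
    (h : ¬ ∃ s < T, Deficient (threshold K T δ) p s) (t : Fin T) (x : Fin t → ℝ) (k : Fin K) :
    strategy A a τ T δ r t (past p t) x k = scale K T δ *
      (1 - A.prob t (A.info t (past p t) x k) (communicate a (A.info t (past p t) x) τ k)) := by
  refine if_neg ?_
  rintro ⟨s, hs, hd⟩
  exact h ⟨s, hs.trans_lt t.isLt, (deficient_past _ p t hs).1 ⟨k, hd⟩⟩

lemma cooperation_of_not_deficient {K T : ℕ} (A : Algorithm K) (a : Matrix (Fin K) (Fin K) ℝ)
    (τ : ℕ) (δ : ℝ) {p : Fin T → Fin K}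
    (h : ¬ ∃ s < T, Deficient (threshold K T δ) p s) (t : Fin T) (x : Fin t → ℝ) (k : Fin K) :
    cooperation A a τ T δ t (past p t) x k = scale K T δ *
      (1 - A.prob t (A.info t (past p t) x k) (communicate a (A.info t (past p t) x) τ k)) := by
  refine if_neg ?_
  rintro ⟨s, hs, hd⟩
  exact h ⟨s, hs.trans_lt t.isLt, (deficient_past _ p t hs).1 hd⟩

open Classical in
/-- Deficiencies are equally likely under the strategy and under its cooperative truncation. -/
lemma sum_pathProb_strategy_deficient {K T : ℕ} (A : Algorithm K) (a : Matrix (Fin K) (Fin K) ℝ)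
    (τ : ℕ) (δ : ℝ) (r : ℕ → Fin K → ℝ) :
    ∑ p : Fin T → Fin K with ∃ s < T, Deficient (threshold K T δ) p s,
        pathProb A (strategy A a τ T δ r) p =
      ∑ p : Fin T → Fin K with ∃ s < T, Deficient (threshold K T δ) p s,
        pathProb A (cooperation A a τ T δ) p := by
  have h1 := Finset.sum_filter_add_sum_filter_not Finset.univ
    (fun p : Fin T → Fin K => ∃ s < T, Deficient (threshold K T δ) p s)
    (pathProb A (strategy A a τ T δ r))
  have h2 := Finset.sum_filter_add_sum_filter_not Finset.univ
    (fun p : Fin T → Fin K => ∃ s < T, Deficient (threshold K T δ) p s)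
    (pathProb A (cooperation A a τ T δ))
  rw [sum_pathProb] at h1 h2
  -- The two rules agree on every path of the complementary event, and both total masses are `1`.
  have h3 : ∑ p : Fin T → Fin K with ¬ ∃ s < T, Deficient (threshold K T δ) p s,
        pathProb A (strategy A a τ T δ r) p =
      ∑ p : Fin T → Fin K with ¬ ∃ s < T, Deficient (threshold K T δ) p s,
        pathProb A (cooperation A a τ T δ) p := by
    refine Finset.sum_congr rfl fun p hp => ?_
    have hp' := (Finset.mem_filter.1 hp).2
    exact pathProb_congr A p fun t x k => by
      rw [strategy_of_not_deficient A a τ δ r hp', cooperation_of_not_deficient A a τ δ hp']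
  linarith

open Classical in
-- Union bound: a deficiency requires either large regret, which costs `ρ`, or a very negative
-- corrected count of one of the `K` arms.
lemma sum_pathProb_deficient_le {K T τ : ℕ} (hK : 1 ≤ K) {δ ρ ε : ℝ} {A : Algorithm K}
    {a : Matrix (Fin K) (Fin K) ℝ} (hA : A.IsLowRegret T ρ δ) (hθ0 : 0 < scale K T δ)
    (hθ1 : scale K T δ ≤ 1)
    (hε : ∀ t < T, ∀ (p : Fin t → Fin K) x, (∀ s, x s ∈ Set.Icc (0 : ℝ) 1) → ∀ k,
      |A.prob t (A.info t p x k) (communicate a (A.info t p x) τ k) - A.pullProb t p x k| ≤ ε)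
    {l u : ℝ} (hl0 : 0 ≤ l) (hl : l ≤ 1 / 2)
    (hu : -threshold K T δ + δ / scale K T δ + 2 * ε * T ≤ -u) :
    ∑ p : Fin T → Fin K with ∃ s < T, Deficient (threshold K T δ) p s,
      pathProb A (cooperation A a τ T δ) p ≤ ρ + K * Real.exp (4 * l ^ 2 * T - l * u) := by
  set σ := cooperation A a τ T δ with hσ
  have hmem := cooperation_mem A a τ T hθ1
  have h1 := Finset.sum_filter_add_sum_filter_not Finset.univ
    (fun p : Fin T → Fin K => regret σ p ≤ δ) (pathProb A σ)
  rw [sum_pathProb] at h1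
  have h2 := hA σ hmem
  have h3 : ∑ p : Fin T → Fin K with ¬ regret σ p ≤ δ, pathProb A σ p ≤ ρ := by linarith
  have h4 : ∑ k : Fin K, ∑ p : Fin T → Fin K with
      ∑ t : Fin T, shareGap A σ (threshold K T δ) k t (past p t) (p t) ≤ -u, pathProb A σ p ≤
      K * Real.exp (4 * l ^ 2 * T - l * u) := by
    refine (Finset.sum_le_sum fun k _ => sum_pathProb_filter_le A σ
      (shareGap A σ (threshold K T δ) k) (abs_shareGap_le hK A σ _ k)
      (sum_pullProb_mul_shareGap_nonneg hK A σ _ k) hl0 hl T u).trans ?_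
    simp
  refine le_trans ?_ (add_le_add h3 h4)
  simp only [Finset.sum_filter]
  rw [Finset.sum_comm, ← Finset.sum_add_distrib]
  refine Finset.sum_le_sum fun p _ => ?_
  have hp := pathProb_nonneg A σ p
  have hterm : ∀ k : Fin K, 0 ≤ if ∑ t : Fin T, shareGap A σ (threshold K T δ) k t (past p t) (p t)
      ≤ -u then pathProb A σ p else 0 := fun k => by split_ifs <;> simp [hp]
  have hsum := Finset.sum_nonneg fun k (_ : k ∈ Finset.univ) => hterm k
  by_cases hd : ∃ s < T, Deficient (threshold K T δ) p s
  · rw [if_pos hd]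
    by_cases hr : regret σ p ≤ δ
    · obtain ⟨k, hk⟩ := exists_sum_shareGap_le hθ0 p
        (fun t k => hε t t.isLt _ _ (reports_mem hmem _) k) hr hd
      rw [if_neg (not_not.2 hr), zero_add]
      refine le_trans ?_ (Finset.single_le_sum (fun k _ => hterm k) (Finset.mem_univ k))
      rw [if_pos (hk.trans hu)]
    · rw [if_pos hr]
      linarith
  · rw [if_neg hd]
    refine add_nonneg ?_ hsum
    split_ifs <;> simp [hp]

/-! ### The revenue -/

lemma scale_mul {K T : ℕ} (hT : 0 < T) (δ : ℝ) :
    T * scale K T δ = √(K * T * δ) := by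
  have hT' : (0 : ℝ) < T := by exact_mod_cast hT
  rw [scale, ← Real.sqrt_sq hT'.le, ← Real.sqrt_mul (by positivity), Real.sqrt_sq hT'.le]
  congr 1
  field_simp

lemma sum_pathProb_mul_revenue_le {K T : ℕ} (A : Algorithm K) {σ : OfferRule K} {M : ℝ}
    (h : ∀ t p x k, σ t p x k ≤ M) :
    ∑ p : Fin T → Fin K, pathProb A σ p * revenue σ p ≤ T * M := by
  calc _ ≤ ∑ p : Fin T → Fin K, pathProb A σ p * (T * M) := by
        refine Finset.sum_le_sum fun p _ => mul_le_mul_of_nonneg_left ?_ (pathProb_nonneg _ _ _)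
        refine (Finset.sum_le_sum fun t _ => h _ _ _ (p t)).trans ?_
        simp
    _ = T * M := by rw [← Finset.sum_mul, sum_pathProb, one_mul]

open Classical in
/-- The revenue is at most `θ` per round unless a deficiency occurs. -/
lemma sum_pathProb_mul_revenue_strategy_le {K T : ℕ} (A : Algorithm K)
    (a : Matrix (Fin K) (Fin K) ℝ) (τ : ℕ) {δ : ℝ} (hθ : scale K T δ ≤ 1)
    {r : ℕ → Fin K → ℝ} (hr : ∀ t k, r t k ∈ Set.Icc (0 : ℝ) 1) :
    ∑ p : Fin T → Fin K, pathProb A (strategy A a τ T δ r) p *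
        revenue (strategy A a τ T δ r) p ≤
      T * scale K T δ + T * ∑ p : Fin T → Fin K with
        ∃ s < T, Deficient (threshold K T δ) p s, pathProb A (strategy A a τ T δ r) p := by
  set σ := strategy A a τ T δ r with hσ
  have h0 : 0 ≤ scale K T δ := Real.sqrt_nonneg _
  have hpt : ∀ p : Fin T → Fin K, pathProb A σ p * revenue σ p ≤
      pathProb A σ p * (T * scale K T δ) +
        T * if ∃ s < T, Deficient (threshold K T δ) p s then pathProb A σ p else 0 := by
    intro p
    have hp := pathProb_nonneg A σ p
    split_ifs with hd
    · have : revenue σ p ≤ T := by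
        refine (Finset.sum_le_sum fun t _ => (strategy_le A a τ T δ hr _ _ _ (p t)).trans_eq
          (max_eq_left hθ)).trans ?_
        simp
      have h1 := mul_le_mul_of_nonneg_left this hp
      have h2 : 0 ≤ pathProb A σ p * (T * scale K T δ) := by positivity
      linarith
    · rw [mul_zero, add_zero]
      refine mul_le_mul_of_nonneg_left ?_ hp
      have : ∀ t, offer σ p t (p t) ≤ scale K T δ := by
        intro t
        refine (strategy_of_not_deficient A a τ δ r hd t _ (p t)).trans_le ?_
        have := A.prob_mem t (A.info t (past p t) (reports σ t (past p t)) (p t))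
          (communicate a (A.info t (past p t) (reports σ t (past p t))) τ (p t))
        nlinarith [this.1]
      refine (Finset.sum_le_sum fun t _ => this t).trans ?_
      simp
  refine (Finset.sum_le_sum fun p _ => hpt p).trans_eq ?_
  rw [Finset.sum_add_distrib, ← Finset.sum_mul, sum_pathProb, one_mul, ← Finset.mul_sum,
    Finset.sum_filter]

/-- The constant `3` collects `T θ = Q` from cooperation and `T (ρ + K / T) ≤ 1 + K ≤ 2 Q` from
deficient paths. The bound holds for each realization of the rewards. -/
lemma revenueGivenRewards_le {K T τ : ℕ} (hK : 1 ≤ K) (hT : 2 ≤ T) {δ ρ : ℝ} {A : Algorithm K}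
    {a : Matrix (Fin K) (Fin K) ℝ} (hρ : ρ ≤ 1 / (T : ℝ) ^ 2) (hδ : √(T * Real.log T) ≤ δ)
    (hA : A.IsLowRegret T ρ δ)
    (hε : ∀ t < T, ∀ (p : Fin t → Fin K) x, (∀ s, x s ∈ Set.Icc (0 : ℝ) 1) → ∀ k,
      |A.prob t (A.info t p x k) (communicate a (A.info t p x) τ k) - A.pullProb t p x k| ≤
        1 / (2 * T))
    (r : ℕ × Fin K → unitInterval) :
    revenueGivenRewards A a τ T δ r ≤ 3 * √(K * T * δ) := by
  classical
  have hr : ∀ t k, ((r (t, k) : unitInterval) : ℝ) ∈ Set.Icc (0 : ℝ) 1 := fun t k => (r (t, k)).2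
  have hK' : (1 : ℝ) ≤ K := by exact_mod_cast hK
  have hT' : (2 : ℝ) ≤ T := by exact_mod_cast hT
  have hlog : 1 / 2 ≤ Real.log T := by
    have := Real.log_le_log (by norm_num) hT'
    linarith [Real.log_two_gt_d9]
  have hlogT : Real.log T ≤ T := (Real.log_le_self (by linarith))
  set w := √(T * Real.log T) with hw
  have hw2 : w ^ 2 = T * Real.log T := Real.sq_sqrt (by positivity)
  have hw1 : 1 ≤ w := by
    rw [hw, Real.one_le_sqrt]
    nlinarith
  have hwT : w ≤ T := by
    rw [hw, Real.sqrt_le_left (by linarith)]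
    nlinarith
  have hδ1 : 1 ≤ δ := hw1.trans hδ
  set Q := √(K * T * δ) with hQ
  have hθ0 : 0 < scale K T δ := Real.sqrt_pos.2 (by positivity)
  have hTθ : T * scale K T δ = Q := scale_mul (by omega) δ
  have hQ0 : 0 ≤ Q := Real.sqrt_nonneg _
  -- For `θ ≥ 1` the truncated offers may leave `[0, 1]`, but then every offer is at most `θ` and
  -- the total is trivially at most `Q`.
  rcases le_or_gt 1 (scale K T δ) with hθ | hθ
  · have h1 : revenueGivenRewards A a τ T δ r ≤ T * scale K T δ :=
      sum_pathProb_mul_revenue_le A fun t p x k =>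
        (strategy_le A a τ T δ hr t p x k).trans_eq (max_eq_right hθ)
    linarith
  have hKδ : K * δ < T := by
    have h := (Real.sqrt_lt' one_pos).1 hθ
    rw [one_pow, div_lt_one (by linarith)] at h
    exact h
  have hδK : δ ≤ K * δ := le_mul_of_one_le_left (by linarith) hK'
  have hKK : (K : ℝ) ≤ K * δ := le_mul_of_one_le_right (by linarith) hδ1
  have hTδ : T * δ ≤ K * T * δ := by
    rw [mul_assoc]
    exact le_mul_of_one_le_left (by positivity) hK'
  have hδQ : δ ≤ Q := Real.le_sqrt_of_sq_le (by nlinarith)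
  have hKQ : (K : ℝ) ≤ Q := by
    refine Real.le_sqrt_of_sq_le ?_
    calc (K : ℝ) ^ 2 = K * K := sq _
      _ ≤ K * T := mul_le_mul_of_nonneg_left (hKK.trans hKδ.le) (by positivity)
      _ ≤ K * T * δ := le_mul_of_one_le_right (by positivity) hδ1
  have hR : δ / scale K T δ ≤ Q := by
    rw [div_le_iff₀ hθ0]
    have hQ2 : Q ^ 2 = K * T * δ := Real.sq_sqrt (by positivity)
    have : T * δ ≤ T * (Q * scale K T δ) := by
      calc T * δ ≤ K * T * δ := hTδ
        _ = T * (Q * scale K T δ) := by rw [← hQ2, ← hTθ]; ring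
    exact le_of_mul_le_mul_left this (by linarith)
  -- `l = w / (2 T)` minimizes `4 l ^ 2 T - 4 w l`, with value `-w ^ 2 / T = -log T`. The deviation
  -- `4 w` is available because `7 Q - Q - 1 ≥ 4 w`, where `1 ≤ w ≤ δ ≤ Q`.
  have hbad := sum_pathProb_deficient_le (l := w / (2 * T)) (u := 4 * w) hK hA hθ0 hθ.le hε
    (by positivity) (by rw [div_le_div_iff₀ (by positivity) (by norm_num)]; linarith) (by
      have : 2 * (1 / (2 * (T : ℝ))) * T = 1 := by field_simp
      rw [this, threshold]
      linarith)
  have hexp : Real.exp (4 * (w / (2 * T)) ^ 2 * T - w / (2 * T) * (4 * w)) = 1 / T := by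
    have : 4 * (w / (2 * T)) ^ 2 * T - w / (2 * T) * (4 * w) = -Real.log T := by
      have : 4 * (w / (2 * T)) ^ 2 * T - w / (2 * T) * (4 * w) = -(w ^ 2 / T) := by
        field_simp
        ring
      rw [this, hw2]
      field_simp
    rw [this, Real.exp_neg, Real.exp_log (by linarith), one_div]
  rw [hexp, ← sum_pathProb_strategy_deficient A a τ δ fun t k => (r (t, k) : ℝ)] at hbad
  have hrev := sum_pathProb_mul_revenue_strategy_le (T := T) A a τ hθ.le hr
  have hρT : T * ρ ≤ 1 := by
    have h1 := mul_le_mul_of_nonneg_left hρ (by linarith : (0 : ℝ) ≤ T)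
    have h2 : (T : ℝ) * (1 / T ^ 2) = 1 / T := by field_simp
    have h3 : 1 / (T : ℝ) ≤ 1 := by rw [div_le_one] <;> linarith
    linarith
  have hfin := mul_le_mul_of_nonneg_left hbad (by linarith : (0 : ℝ) ≤ T)
  have hK1 : (T : ℝ) * (ρ + K * (1 / T)) = T * ρ + K := by field_simp
  change ∑ p : Fin T → Fin K, _ ≤ _
  linarith

/-! ### Measurability -/

lemma measurable_communicate {K : ℕ} (a : Matrix (Fin K) (Fin K) ℝ) (n : ℕ) (k : Fin K) :
    Measurable fun I : Fin K → ℝ => communicate a I n k := by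
  induction n generalizing k with
  | zero => exact measurable_pi_apply k
  | succ n ih => exact Finset.measurable_sum _ fun l _ => (ih l).const_mul _

lemma Algorithm.measurable_pullProb {K : ℕ} (A : Algorithm K) (t : ℕ) (p : Fin t → Fin K)
    (k : Fin K) : Measurable fun x => A.pullProb t p x k :=
  (A.measurable_prob t).comp ((A.measurable_info t p k).prodMk
    ((Finset.measurable_sum _ fun l _ => A.measurable_info t p l).div_const _))

section

variable {Ω : Type*} [MeasurableSpace Ω] {K : ℕ} {σ : Ω → OfferRule K}

/-- Joint measurability is assumed because earlier reports, themselves functions of `ω`, are fed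
back into the rule. -/
lemma measurable_reports (h : ∀ t p k, Measurable fun z : Ω × (Fin t → ℝ) => σ z.1 t p z.2 k)
    {n : ℕ} (p : Fin n → Fin K) : Measurable fun ω => reports (σ ω) n p := by
  induction n with
  | zero => exact measurable_pi_iff.2 fun t => t.elim0
  | succ n ih =>
    refine measurable_pi_iff.2 fun t => ?_
    refine Fin.lastCases ?_ (fun t => ?_) t
    · simp only [reports, Fin.snoc_last]
      exact (h n (Fin.init p) (p (Fin.last n))).comp (measurable_id.prodMk (ih _))
    · simp only [reports, Fin.snoc_castSucc]
      exact (measurable_pi_apply t).comp (ih _)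

lemma measurable_revenue (h : ∀ t p k, Measurable fun z : Ω × (Fin t → ℝ) => σ z.1 t p z.2 k)
    {T : ℕ} (p : Fin T → Fin K) : Measurable fun ω => revenue (σ ω) p :=
  Finset.measurable_sum _ fun t _ =>
    (h t (past p t) (p t)).comp (measurable_id.prodMk (measurable_reports h _))

lemma measurable_pathProb (A : Algorithm K)
    (h : ∀ t p k, Measurable fun z : Ω × (Fin t → ℝ) => σ z.1 t p z.2 k)
    {T : ℕ} (p : Fin T → Fin K) : Measurable fun ω => pathProb A (σ ω) p :=
  Finset.measurable_prod _ fun t _ =>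
    (A.measurable_pullProb t (past p t) (p t)).comp (measurable_reports h _)

end

lemma measurable_revenueGivenRewards {K : ℕ} (A : Algorithm K) (a : Matrix (Fin K) (Fin K) ℝ)
    (τ T : ℕ) (δ : ℝ) : Measurable (revenueGivenRewards A a τ T δ) := by
  have h : ∀ t (p : Fin t → Fin K) k,
      Measurable fun z : (ℕ × Fin K → unitInterval) × (Fin t → ℝ) =>
        strategy A a τ T δ (fun t k => (z.1 (t, k) : ℝ)) t p z.2 k := by
    intro t p k
    unfold strategy
    -- Defection depends only on the fixed pulls, so the case distinction does not involve the
    -- rewards or reports.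
    split_ifs
    · exact measurable_subtype_coe.comp ((measurable_pi_apply (t, k)).comp measurable_fst)
    · have hI : Measurable fun z : (ℕ × Fin K → unitInterval) × (Fin t → ℝ) =>
          A.info t p z.2 :=
        measurable_pi_iff.2 fun l => (A.measurable_info t p l).comp measurable_snd
      have hp : Measurable fun z : (ℕ × Fin K → unitInterval) × (Fin t → ℝ) =>
          A.prob t (A.info t p z.2 k) (communicate a (A.info t p z.2) τ k) :=
        (A.measurable_prob t).comp (((measurable_pi_apply k).comp hI).prodMk
          ((measurable_communicate a τ k).comp hI))
      exact (hp.const_sub 1).const_mul _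
  exact Finset.measurable_sum _ fun p _ =>
    (measurable_pathProb A h p).mul (measurable_revenue h p)

lemma revenueGivenRewards_nonneg {K : ℕ} (A : Algorithm K) (a : Matrix (Fin K) (Fin K) ℝ)
    (τ T : ℕ) (δ : ℝ) (r : ℕ × Fin K → unitInterval) : 0 ≤ revenueGivenRewards A a τ T δ r :=
  Finset.sum_nonneg fun _ _ => mul_nonneg (pathProb_nonneg _ _ _)
    (Finset.sum_nonneg fun _ _ => strategy_nonneg A a τ T δ (fun t k => (r (t, k)).2) _ _ _ _)

instance {K : ℕ} (D : Fin K → ProbabilityMeasure unitInterval) :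
    IsProbabilityMeasure (rewardLaw D) := by
  unfold rewardLaw
  infer_instance

/-- After sufficiently many communication steps the arms know their pulling probabilities up to
`ε`. -/
lemma exists_abs_prob_sub_pullProb_le {K : ℕ} (hK : 1 ≤ K) {a : Matrix (Fin K) (Fin K) ℝ}
    (ha : IsCombinationMatrix a) (L : NNReal) (α : ℝ) (T : ℕ) {ε : ℝ} (hε : 0 < ε) :
    ∃ τ₀ : ℕ, ∀ τ ≥ τ₀, ∀ A : Algorithm K, A.IsLipschitz L → A.DisagreementLE T α →
      ∀ t < T, ∀ (p : Fin t → Fin K) x, (∀ s, x s ∈ Set.Icc (0 : ℝ) 1) → ∀ k,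
        |A.prob t (A.info t p x k) (communicate a (A.info t p x) τ k) - A.pullProb t p x k| ≤
          ε := by
  -- `L + 1` instead of `L` permits the division also when `L = 0`.
  have hL : (0 : ℝ) < L + 1 := by positivity
  obtain ⟨τ₀, h⟩ := exists_communicate_sub_mean_le hK ha (√(K * α)) (div_pos hε hL)
  refine ⟨τ₀, fun τ hτ A hAL hAD t ht p x hx k => ?_⟩
  have h1 := h τ hτ (A.info t p x) (abs_sub_mean_le hK (hAD t ht p x hx)) k
  have h2 := (hAL t (A.info t p x k)).dist_le_mul (communicate a (A.info t p x) τ k)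
    (mean (A.info t p x))
  rw [Real.dist_eq, Real.dist_eq] at h2
  refine h2.trans ((mul_le_mul_of_nonneg_left h1 L.coe_nonneg).trans ?_)
  rw [← mul_div_assoc, div_le_iff₀ hL]
  nlinarith

end StrategicBandit
end

/-! ### Main theorem -/

open StrategicBandit in
theorem corollary2 :
    ∃ C : ℝ, 0 < C ∧
      ∀ (K T : ℕ) (δ ρ : ℝ) (a : Matrix (Fin K) (Fin K) ℝ) (L : NNReal) (α : ℝ),
        1 ≤ K → 2 ≤ T →
        (K : ℝ) ≤ (T : ℝ) ^ (1 / 3 : ℝ) / Real.log T →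
        ρ ≤ 1 / (T : ℝ) ^ 2 →
        √(T * Real.log T) ≤ δ →
        IsCombinationMatrix a →
        ∃ τ₀ : ℕ, ∀ τ ≥ τ₀, ∀ A : Algorithm K,
          A.IsLowRegret T ρ δ → A.IsLipschitz L → A.DisagreementLE T α →
          ∀ D : Fin K → MeasureTheory.ProbabilityMeasure unitInterval,
            MeasureTheory.Integrable (revenueGivenRewards A a τ T δ) (rewardLaw D) ∧
            ∫ r, revenueGivenRewards A a τ T δ r ∂(rewardLaw D) ≤ C * √(K * T * δ) := by
  refine ⟨3, by norm_num, fun K T δ ρ a L α hK hT _ hρ hδ ha => ?_⟩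
  have hT0 : (0 : ℝ) < T := by exact_mod_cast (by omega : 0 < T)
  -- With `ε = 1 / (2 T)` the accumulated estimation error `2 ε T` is `1`.
  obtain ⟨τ₀, h⟩ := exists_abs_prob_sub_pullProb_le hK ha L α T
    (ε := 1 / (2 * T)) (by positivity)
  refine ⟨τ₀, fun τ hτ A hA hAL hAD D => ?_⟩
  have hle := revenueGivenRewards_le hK hT hρ hδ hA (h τ hτ A hAL hAD)
  have hint : Integrable (revenueGivenRewards A a τ T δ) (rewardLaw D) :=
    Integrable.of_bound (measurable_revenueGivenRewards A a τ T δ).aestronglyMeasurable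
      (3 * √(K * T * δ)) (Filter.Eventually.of_forall fun r => by
        rw [Real.norm_of_nonneg (revenueGivenRewards_nonneg A a τ T δ r)]
        exact hle r)
  refine ⟨hint, (integral_mono hint (integrable_const _) hle).trans ?_⟩
  simp
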